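/- Let $G$ be a simple graph with vertex set $V$. For $x,y\in V$ let $\mathrm{rel}(x,y)$ be the one of the three values *equal*, *adjacent*, *distinct and non-adjacent* that describes the pair $(x,y)$. A *quantum automorphism* of $G$ is a pair $(H,u)$ consisting of a complex Hilbert space $H$ of arbitrary (finite or infinite) dimension and a family $u=(u_{xy})_{x,y\in V}$ of orthogonal projections in $B(H)$ such that - $u_{xy}u_{xz}=0$ and $u_{yx}u_{zx}=0$ for all $x,y,z \in V$ with $y\neq z$; - $\sum_{z\in V}u_{xz}=1=\sum_{z\in V}u_{zy}$ for all $x,y\in V$, in the strong operator topology; - $u_{x_1y_1}u_{x_2y_2}=0$ whenever $\mathrm{rel}(x_1,x_2)\neq\mathrm{rel}(y_1,y_2)$. It is *irreducible* if $H\neq 0$ and every $T\in B(H)$ with $Tu_{xy}=u_{xy}T$ for all $x,y\in V$ is a scalar multiple of the identity. The graph $G$ has *no quantum symmetry* if every irreducible quantum automorphism of $G$ is one-dimensional. The infinite Johnson graph $J(\infty,2)$ has as vertices all $2$-element subsets of $\mathbb N$, two of them being adjacent iff their intersection has exactly one element. The Kneser graph $K(\infty,2)$ has the same vertices, two of them being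 adjacent iff they are disjoint. **Proposition.** The Johnson graph $J(\infty,2)$ has no quantum symmetry; moreover, for every quantum automorphism $(H,u)$ of $J(\infty,2)$ the entries $u_{xy}$ pairwise commute. Likewise, the Kneser graph $K(\infty,2)$ has no quantum symmetry, and the entries of every quantum automorphism of $K(\infty,2)$ pairwise commute. -/

import Mathlib

universe v w

namespace QuantumSymmetry

section Graphs

/-- The three possible relations between two vertices of a graph. -/
inductive VertexRel where
  | equal
  | adjacent
  | distinctNonadjacent

open Classical in
/-- The function `rel` describing the adjacency relation of a pair of vertices. -/
noncomputable def rel {V : Type v} (G : SimpleGraph V) (x y : V) : VertexRel :=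
  if x = y then .equal else if G.Adj x y then .adjacent else .distinctNonadjacent

/-- The Johnson graph `J(∞, k)`: its vertices are the `k`-element subsets of `ℕ`, and two of them
are adjacent iff their intersection has `k - 1` elements. -/
def johnsonGraph (k : ℕ) : SimpleGraph {s : Finset ℕ // s.card = k} where
  Adj s t := (s.1 ∩ t.1).card + 1 = k
  symm := ⟨fun s t h => by rw [Finset.inter_comm]; exact h⟩
  loopless := ⟨fun s h => by
    rw [Finset.inter_self, s.2] at h
    omega⟩

/-- The Kneser graph `K(∞, 2)`: its vertices are the `2`-element subsets of `ℕ`, and two of them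
are adjacent iff their intersection is empty. -/
def kneserGraphTwo : SimpleGraph {s : Finset ℕ // s.card = 2} where
  Adj s t := s.1 ∩ t.1 = ∅
  symm := ⟨fun s t h => by rw [Finset.inter_comm]; exact h⟩
  loopless := ⟨fun s h => by
    have h2 := s.2
    rw [Finset.inter_self] at h
    rw [h] at h2
    simp at h2⟩

end Graphs

section Operators

variable {V : Type v} {H : Type w} [NormedAddCommGroup H] [InnerProductSpace ℂ H] [CompleteSpace H]

/-- `(H, u)` is a quantum permutation of the set `V`: the `u x y` are orthogonal projections, those
in a common row or column are pairwise orthogonal, and all rows and columns sum to the identity in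
the strong operator topology. -/
structure IsQuantumPermutation (u : V → V → (H →L[ℂ] H)) : Prop where
  isStarProjection : ∀ x y, IsStarProjection (u x y)
  row_orthogonal : ∀ x y z, y ≠ z → u x y * u x z = 0
  col_orthogonal : ∀ y x z, x ≠ z → u x y * u z y = 0
  row_sum : ∀ x, ∀ ξ : H, HasSum (fun z => u x z ξ) ξ
  col_sum : ∀ y, ∀ ξ : H, HasSum (fun z => u z y ξ) ξ

/-- `(H, u)` is a quantum automorphism of the graph `G`. -/
structure IsQuantumAutomorphism (G : SimpleGraph V) (u : V → V → (H →L[ℂ] H)) : Prop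
    extends IsQuantumPermutation u where
  mul_eq_zero_of_rel_ne : ∀ x₁ x₂ y₁ y₂, rel G x₁ x₂ ≠ rel G y₁ y₂ → u x₁ y₁ * u x₂ y₂ = 0

/-- `(H, u)` is irreducible: `H` is nonzero and the only intertwiners from `(H, u)` to itself are
the multiples of the identity. -/
def IsIrreducible (u : V → V → (H →L[ℂ] H)) : Prop :=
  Nontrivial H ∧
    ∀ T : H →L[ℂ] H, (∀ x y, T * u x y = u x y * T) → ∃ c : ℂ, T = c • (1 : H →L[ℂ] H)

end Operators

/-- A graph has no quantum symmetry if each of its irreducible quantum automorphisms, on a Hilbert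
space of any dimension, is one-dimensional. -/
def HasNoQuantumSymmetry {V : Type v} (G : SimpleGraph V) : Prop :=
  ∀ (H : Type w) [NormedAddCommGroup H] [InnerProductSpace ℂ H] [CompleteSpace H]
    (u : V → V → (H →L[ℂ] H)),
    IsQuantumAutomorphism G u → IsIrreducible u → Module.finrank ℂ H = 1

/-- The entries of each quantum automorphism of the graph, on a Hilbert space of any dimension,
pairwise commute. -/
def QuantumAutomorphismEntriesCommute {V : Type v} (G : SimpleGraph V) : Prop :=
  ∀ (H : Type w) [NormedAddCommGroup H] [InnerProductSpace ℂ H] [CompleteSpace H]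
    (u : V → V → (H →L[ℂ] H)),
    IsQuantumAutomorphism G u → ∀ x y x' y', u x y * u x' y' = u x' y' * u x y

end QuantumSymmetry

/-! In both graphs `rel` determines the size of an intersection, so `u e f * u e' f' = 0` unless `e
∩ e'` and `f ∩ f'` have equal size. Let `P e x` be the projection for the event "the image of `e`
contains `x`". For disjoint pairs partitioning a four-element set, `P {a,b} x + P {c,d} x` does not
depend on the partition (`add_eq_add`). Linear algebra then gives `P {a,b} x = v a x + v b x`
(`exists_add_of_exchange`), and the `v a x` are projections, orthogonal for fixed `x`
(`exists_pointwise`). They act as a quantum permutation of the points would.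

Infinity enters once: `v a x * v a y` with `x ≠ y` factors through `u {a,n} {x,y}` for every `n >
a`, and these entries tend strongly to zero, so it vanishes. Symmetry of `P e x * P e y = u e {x,y}`
in `x` and `y` then makes all `v a x` commute, hence all entries. By irreducibility, commuting
entries are scalars, which forces dimension one. -/

namespace QuantumSymmetry

/-! ### Algebra of functions on pairs: additive splitting and orthogonality. -/

section Ring

variable {A : Type*} [Ring A] [Algebra ℂ A]

/-- A function on pairs satisfying the exchange relation splits as a sum over the two points. -/
theorem exists_add_of_exchange (p : ℕ → ℕ → A) (symm : ∀ a b, p a b = p b a)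
    (exch : ∀ a b c d, a ≠ b → a ≠ c → a ≠ d → b ≠ c → b ≠ d → c ≠ d →
      p a b + p c d = p a c + p b d) :
    ∃ v : ℕ → A, ∀ a b, a ≠ b → p a b = v a + v b := by
  have step : ∀ a b c d, a ≠ b → a ≠ c → a ≠ d → b ≠ c → b ≠ d → c ≠ d →
      p a b + p a c - p b c = p a b + p a d - p b d := by
    intro a b c d hab hac had hbc hbd hcd
    have h := exch a c b d hac hab had hbc.symm hcd hbd
    have h2 := exch a d b c had hab hac hbd.symm hcd.symm hbc
    rw [symm d c] at h2
    have h3 : p a c + p b d = p a d + p b c := by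
      rw [h, h2]
    rw [add_sub_assoc, add_sub_assoc, sub_eq_sub_iff_add_eq_add.mpr h3]
  have swap : ∀ a b c, p a b + p a c - p b c = p a c + p a b - p c b := by
    intro a b c
    rw [symm b c, add_comm]
  have indep : ∀ a b c b' c', a ≠ b → a ≠ c → b ≠ c → a ≠ b' → a ≠ c' → b' ≠ c' →
      p a b + p a c - p b c = p a b' + p a c' - p b' c' := by
    intro a b c b' c' hab hac hbc hab' hac' hbc'
    obtain ⟨d, hd⟩ := Infinite.exists_notMem_finset ({a, b, c, b', c'} : Finset ℕ)
    obtain ⟨e, he⟩ := Infinite.exists_notMem_finset ({a, b, c, b', c', d} : Finset ℕ)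
    simp only [Finset.mem_insert, Finset.mem_singleton, not_or] at hd he
    -- Any two pairs of auxiliary points are compared through a fresh pair `d, e`, replacing one
    -- point at a time.
    have key : ∀ x y, a ≠ x → a ≠ y → x ≠ y → d ≠ x → d ≠ y → e ≠ x → e ≠ y →
        p a x + p a y - p x y = p a d + p a e - p d e := by
      intro x y hx hy hxy hdx hdy hex hey
      rw [step a x y d hx hy (Ne.symm hd.1) hxy hdx.symm hdy.symm, swap a x d,
        step a d x e (Ne.symm hd.1) hx (Ne.symm he.1) hdx (Ne.symm he.2.2.2.2.2) hex.symm]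
    rw [key b c hab hac hbc (by tauto) (by tauto) (by tauto) (by tauto),
      key b' c' hab' hac' hbc' (by tauto) (by tauto) (by tauto) (by tauto)]
  -- If `p a b = v a + v b`, then `p a b + p a c - p b c = 2 v a`; by `indep` the choice `a + 1`, `a
  -- + 2` is immaterial.
  refine ⟨fun a => (2⁻¹ : ℂ) • (p a (a + 1) + p a (a + 2) - p (a + 1) (a + 2)), ?_⟩
  intro a b hab
  obtain ⟨c, hc⟩ := Infinite.exists_notMem_finset ({a, b} : Finset ℕ)
  simp only [Finset.mem_insert, Finset.mem_singleton, not_or] at hc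
  beta_reduce
  rw [indep a (a + 1) (a + 2) b c (by omega) (by omega) (by omega) hab (Ne.symm hc.1)
      (Ne.symm hc.2),
    indep b (b + 1) (b + 2) a c (by omega) (by omega) (by omega) hab.symm (Ne.symm hc.2)
      (Ne.symm hc.1), ← smul_add, symm b a]
  have : p a b + p a c - p b c + (p a b + p b c - p a c) = (2 : ℂ) • p a b := by
    rw [two_smul]; abel
  rw [this, smul_smul]
  norm_num

/-- If the sums of two values are idempotents which are orthogonal for disjoint pairs, then the
values are orthogonal idempotents. -/
theorem orthogonal_idempotents_of_add (v : ℕ → A)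
    (idem : ∀ a b, a ≠ b → IsIdempotentElem (v a + v b))
    (orth : ∀ a b c d, a ≠ b → a ≠ c → a ≠ d → b ≠ c → b ≠ d → c ≠ d →
      (v a + v b) * (v c + v d) = 0) :
    (∀ a, IsIdempotentElem (v a)) ∧ ∀ a b, a ≠ b → v a * v b = 0 := by
  have half : ∀ x : A, x + x = 0 → x = 0 := by
    intro x hx
    rw [← two_smul ℂ x] at hx
    exact (smul_eq_zero_iff_right (two_ne_zero)).1 hx
  have h1 : ∀ a b c, a ≠ b → a ≠ c → b ≠ c → (v a + v b) * v c = 0 := by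
    intro a b c hab hac hbc
    obtain ⟨d, hd⟩ := Infinite.exists_notMem_finset ({a, b, c} : Finset ℕ)
    obtain ⟨e, he⟩ := Infinite.exists_notMem_finset ({a, b, c, d} : Finset ℕ)
    simp only [Finset.mem_insert, Finset.mem_singleton, not_or] at hd he
    have e1 := orth a b c d hab hac (by tauto) hbc (by tauto) (by tauto)
    have e2 := orth a b c e hab hac (by tauto) hbc (by tauto) (by tauto)
    have e3 := orth a b d e hab (by tauto) (by tauto) (by tauto) (by tauto) (by tauto)
    rw [mul_add] at e1 e2 e3
    -- The values `(v a + v b) * v i` for `i = c, d, e` have pairwise sums zero, so each of them is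
    -- zero.
    apply half
    calc _ = ((v a + v b) * v c + (v a + v b) * v d) + ((v a + v b) * v c + (v a + v b) * v e)
          - ((v a + v b) * v d + (v a + v b) * v e) := by abel
      _ = 0 := by rw [e1, e2, e3]; simp
  have h2 : ∀ a b, a ≠ b → v a * v b = 0 := by
    intro a b hab
    obtain ⟨d, hd⟩ := Infinite.exists_notMem_finset ({a, b} : Finset ℕ)
    obtain ⟨e, he⟩ := Infinite.exists_notMem_finset ({a, b, d} : Finset ℕ)
    simp only [Finset.mem_insert, Finset.mem_singleton, not_or] at hd he
    have e1 := h1 a d b (by tauto) hab (by tauto)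
    have e2 := h1 a e b (by tauto) hab (by tauto)
    have e3 := h1 d e b (by tauto) (by tauto) (by tauto)
    rw [add_mul] at e1 e2 e3
    apply half
    calc _ = (v a * v b + v d * v b) + (v a * v b + v e * v b)
          - (v d * v b + v e * v b) := by abel
      _ = 0 := by rw [e1, e2, e3]; simp
  refine ⟨fun a => ?_, h2⟩
  have h3 : ∀ a b, a ≠ b → (v a * v a - v a) + (v b * v b - v b) = 0 := by
    intro a b hab
    have h := idem a b hab
    unfold IsIdempotentElem at h
    rw [add_mul, mul_add, mul_add, h2 a b hab, h2 b a hab.symm, add_zero, zero_add] at h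
    rw [sub_add_sub_comm, h, sub_self]
  have e1 := h3 a (a + 1) (by omega)
  have e2 := h3 a (a + 2) (by omega)
  have e3 := h3 (a + 1) (a + 2) (by omega)
  refine sub_eq_zero.1 (half _ ?_)
  calc _ = ((v a * v a - v a) + (v (a + 1) * v (a + 1) - v (a + 1)))
        + ((v a * v a - v a) + (v (a + 2) * v (a + 2) - v (a + 2)))
        - ((v (a + 1) * v (a + 1) - v (a + 1)) + (v (a + 2) * v (a + 2) - v (a + 2))) := by abel
    _ = 0 := by rw [e1, e2, e3]; simp

end Ring

/-! ### Projections and strongly convergent partitions of unity. -/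

section Hilbert

variable {V : Type v} {ι : Type*} {H : Type w} [NormedAddCommGroup H] [InnerProductSpace ℂ H]
  [CompleteSpace H]

/-- A partition of unity into orthogonal projections can be coarsened along any subset. -/
theorem exists_coarsening (q : ι → (H →L[ℂ] H)) (hq : ∀ i, IsStarProjection (q i))
    (orth : ∀ i j, i ≠ j → q i * q j = 0) (S : Set ι) :
    ∃ P : H →L[ℂ] H, IsStarProjection P ∧ (∀ i ∈ S, P * q i = q i) ∧
      ∀ i ∉ S, P * q i = 0 := by
  -- The common kernel of the `q i` with `i ∉ S` replaces the strong sum over `S`, so no convergence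
  -- is needed.
  let K : Submodule ℂ H := ⨅ i : {i // i ∉ S}, (q i).ker
  have hK : IsClosed (K : Set H) := by
    simp only [K, Submodule.coe_iInf]
    exact isClosed_iInter fun i => (q i).isClosed_ker
  have : CompleteSpace K := hK.completeSpace_coe
  have hP : IsStarProjection K.starProjection := isStarProjection_starProjection
  refine ⟨K.starProjection, hP, ?_, ?_⟩
  · intro i hi
    ext ξ
    refine Submodule.starProjection_eq_self_iff.2 ?_
    refine Submodule.mem_iInf _ |>.2 fun j => ?_
    have hj : (j : ι) ≠ i := fun h => j.2 (h ▸ hi)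
    have := congrArg (fun T : H →L[ℂ] H => T ξ) (orth j i hj)
    simpa using this
  · intro i hi
    have h : q i * K.starProjection = 0 := by
      ext ξ
      have : K.starProjection ξ ∈ K := Submodule.starProjection_apply_mem _ _
      simpa using (Submodule.mem_iInf _).1 this ⟨i, hi⟩
    have h2 := congrArg star h
    rwa [star_mul, hP.isSelfAdjoint.star_eq, (hq i).isSelfAdjoint.star_eq, star_zero] at h2

theorem inner_starProjection_apply_self {p : H →L[ℂ] H} (hp : IsStarProjection p) (x : H) :
    inner ℂ x (p x) = (‖p x‖ : ℂ) ^ 2 := by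
  refine Eq.trans ?_ (inner_self_eq_norm_sq_to_K (𝕜 := ℂ) (p x))
  have h1 : p x = p (p x) :=
    (congrArg (fun T : H →L[ℂ] H => T x) hp.isIdempotentElem.eq).symm
  conv_lhs => rw [h1]
  conv_lhs => rw [← ContinuousLinearMap.adjoint_inner_left, ← ContinuousLinearMap.star_eq_adjoint,
    hp.isSelfAdjoint.star_eq]

/-- Two projections whose mean fixes a vector both fix it. -/
theorem starProjection_apply_eq_of_add_apply {p q : H →L[ℂ] H} (hp : IsStarProjection p)
    (hq : IsStarProjection q) {x : H} (h : p x + q x = x + x) : p x = x := by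
  have h1 := inner_starProjection_apply_self hp.one_sub x
  have h2 := inner_starProjection_apply_self hq.one_sub x
  have h3 : (1 - p) x + (1 - q) x = 0 := by
    change (x - p x) + (x - q x) = 0
    rw [sub_add_sub_comm, h, sub_self]
  have h4 : ((‖(1 - p) x‖ : ℂ) ^ 2 + (‖(1 - q) x‖ : ℂ) ^ 2) = 0 := by
    rw [← h1, ← h2, ← inner_add_right, h3, inner_zero_right]
  have h5 : ‖(1 - p) x‖ ^ 2 + ‖(1 - q) x‖ ^ 2 = 0 := by exact_mod_cast h4
  have h6 : ‖(1 - p) x‖ = 0 := by nlinarith [sq_nonneg ‖(1 - p) x‖, sq_nonneg ‖(1 - q) x‖]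
  have h7 : x - p x = 0 := by simpa using h6
  exact (sub_eq_zero.1 h7).symm

theorem starProjection_mul_eq_of_add_mul {p q t : H →L[ℂ] H} (hp : IsStarProjection p)
    (hq : IsStarProjection q) (h : (p + q) * t = t + t) : p * t = t := by
  ext ξ
  exact starProjection_apply_eq_of_add_apply hp hq (by simpa using congrArg (fun T : H →L[ℂ] H => T ξ) h)

omit [CompleteSpace H] in
theorem eq_of_mul_row_eq {q : ι → (H →L[ℂ] H)} (hs : ∀ ξ, HasSum (fun i => q i ξ) ξ)
    {S T : H →L[ℂ] H} (h : ∀ i, S * q i = T * q i) : S = T := by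
  ext ξ
  refine ((hs ξ).mapL S).unique ?_
  convert (hs ξ).mapL T using 2 with i
  exact congrArg (fun T : H →L[ℂ] H => T ξ) (h i)

omit [CompleteSpace H] in
theorem eq_of_row_mul_eq {q : ι → (H →L[ℂ] H)} (hs : ∀ ξ, HasSum (fun i => q i ξ) ξ)
    {S T : H →L[ℂ] H} (h : ∀ i, q i * S = q i * T) : S = T := by
  ext ξ
  refine (hs (S ξ)).unique ?_
  convert hs (T ξ) using 2 with i
  exact congrArg (fun T : H →L[ℂ] H => T ξ) (h i)

omit [CompleteSpace H] in
/-- An irreducible family with pairwise commuting entries acts on a one-dimensional space. -/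
theorem IsIrreducible.finrank_eq_one {u : V → V → (H →L[ℂ] H)} (hu : IsIrreducible u)
    (comm : ∀ x y x' y', u x y * u x' y' = u x' y' * u x y) : Module.finrank ℂ H = 1 := by
  obtain ⟨hH, hu⟩ := hu
  have hsc : ∀ T : H →L[ℂ] H, ∃ c : ℂ, T = c • (1 : H →L[ℂ] H) := by
    intro T
    refine hu T fun x y => ?_
    obtain ⟨c, hc⟩ := hu (u x y) (comm x y)
    rw [hc, mul_smul_comm, smul_mul_assoc, one_mul, mul_one]
  obtain ⟨ξ, hξ⟩ := exists_ne (0 : H)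
  refine _root_.finrank_eq_one ξ hξ fun η => ?_
  -- A rank-one operator that is scalar sends `ξ` to a multiple of any given `η` and of `ξ` at once.
  obtain ⟨c, hc⟩ := hsc ((innerSL ℂ ξ).smulRight η)
  have h := congrArg (fun T : H →L[ℂ] H => T ξ) hc
  change inner ℂ ξ ξ • η = c • ξ at h
  refine ⟨(inner ℂ ξ ξ)⁻¹ * c, ?_⟩
  rw [mul_smul, ← h, inv_smul_smul₀ (inner_self_ne_zero.2 hξ)]

end Hilbert

end QuantumSymmetry

namespace QuantumSymmetry

/-! ### Two-element sets and their intersections. -/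

section Pairs

/-- The two-element subsets of `ℕ`. -/
abbrev Pair := {s : Finset ℕ // s.card = 2}

/-- The two-element set `{a, b}`, with a default value when `a = b`. -/
def pair (a b : ℕ) : Pair :=
  if h : a ≠ b then ⟨{a, b}, Finset.card_pair h⟩ else ⟨{0, 1}, rfl⟩

theorem pair_val {a b : ℕ} (h : a ≠ b) : (pair a b).1 = {a, b} := by
  simp [pair, h]

theorem pair_comm (a b : ℕ) : pair a b = pair b a := by
  rcases eq_or_ne a b with rfl | h
  · rfl
  · apply Subtype.ext
    rw [pair_val h, pair_val h.symm, Finset.pair_comm]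

theorem Pair.exists_eq_pair (f : Pair) : ∃ x y, x ≠ y ∧ f = pair x y := by
  obtain ⟨x, y, h, hf⟩ := Finset.card_eq_two.1 f.2
  exact ⟨x, y, h, Subtype.ext (by rw [hf, pair_val h])⟩

theorem Pair.exists_eq_pair_of_mem {f : Pair} {x : ℕ} (hx : x ∈ f.1) :
    ∃ y, x ≠ y ∧ f = pair x y := by
  obtain ⟨a, b, h, rfl⟩ := f.exists_eq_pair
  rw [pair_val h, Finset.mem_insert, Finset.mem_singleton] at hx
  rcases hx with rfl | rfl
  · exact ⟨b, h, rfl⟩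
  · exact ⟨a, h.symm, pair_comm _ _⟩

theorem mem_pair {a b x : ℕ} (h : a ≠ b) : x ∈ (pair a b).1 ↔ x = a ∨ x = b := by
  rw [pair_val h, Finset.mem_insert, Finset.mem_singleton]

theorem card_inter_pair_disjoint {a b c d : ℕ} (hab : a ≠ b) (hcd : c ≠ d) (hac : a ≠ c)
    (had : a ≠ d) (hbc : b ≠ c) (hbd : b ≠ d) : ((pair a b).1 ∩ (pair c d).1).card = 0 := by
  rw [Finset.card_eq_zero, ← Finset.disjoint_iff_inter_eq_empty, Finset.disjoint_left]
  intro x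
  rw [mem_pair hab, mem_pair hcd]
  rintro (rfl | rfl) <;> tauto

theorem card_inter_pair_share {a b c : ℕ} (hab : a ≠ b) (hac : a ≠ c) (hbc : b ≠ c) :
    ((pair a b).1 ∩ (pair a c).1).card = 1 := by
  rw [Finset.card_eq_one]
  refine ⟨a, ?_⟩
  ext x
  rw [Finset.mem_inter, mem_pair hab, mem_pair hac, Finset.mem_singleton]
  constructor
  · rintro ⟨rfl | rfl, h | h⟩ <;> tauto
  · tauto

theorem pair_eq_of_mem {f : Pair} {x y : ℕ} (h : x ≠ y) (hx : x ∈ f.1) (hy : y ∈ f.1) :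
    f = pair x y := by
  refine Subtype.ext (Finset.eq_of_subset_of_card_le ?_ ?_).symm
  · rw [pair_val h]
    intro z hz
    rw [Finset.mem_insert, Finset.mem_singleton] at hz
    rcases hz with rfl | rfl <;> assumption
  · rw [f.2, (pair x y).2]

theorem Pair.card_inter_eq_two_iff (f g : Pair) : (f.1 ∩ g.1).card = 2 ↔ f = g := by
  constructor
  · intro h
    have h1 := Finset.eq_of_subset_of_card_le (Finset.inter_subset_left (s₁ := f.1) (s₂ := g.1))
      (by rw [h, f.2])
    have h2 := Finset.eq_of_subset_of_card_le (Finset.inter_subset_right (s₁ := f.1) (s₂ := g.1))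
      (by rw [h, g.2])
    exact Subtype.ext (h1.symm.trans h2)
  · rintro rfl
    rw [Finset.inter_self, f.2]

theorem Pair.card_inter_le (f g : Pair) : (f.1 ∩ g.1).card ≤ 2 :=
  (Finset.card_le_card Finset.inter_subset_left).trans f.2.le

/-- If adjacency of distinct pairs is decided by the cardinality of the intersection, then this
cardinality is determined by the relation. -/
theorem card_inter_eq_of_rel_eq {G : SimpleGraph Pair} {k : ℕ} (hk : k < 2)
    (hG : ∀ f g, G.Adj f g ↔ (f.1 ∩ g.1).card = k) {f g f' g' : Pair}
    (h : rel G f g = rel G f' g') : (f.1 ∩ g.1).card = (f'.1 ∩ g'.1).card := by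
  have h1 := f.card_inter_le g
  have h2 := f'.card_inter_le g'
  unfold rel at h
  simp only [← Pair.card_inter_eq_two_iff, hG] at h
  split_ifs at h <;> omega

end Pairs

/-! ### From the coarsened rows to commuting entries. -/

section Commute

variable {H : Type w} [NormedAddCommGroup H] [InnerProductSpace ℂ H] [CompleteSpace H]

/-- A quantum permutation of the pairs compatible with the sizes of intersections, with the
coarsenings `P e x` of its rows to "the image of `e` contains `x`". -/
structure PairCoarsening (u : Pair → Pair → (H →L[ℂ] H)) (P : Pair → ℕ → (H →L[ℂ] H)) : Prop
    extends IsQuantumPermutation u where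
  mul_eq_zero : ∀ e e' f f' : Pair, (e.1 ∩ e'.1).card ≠ (f.1 ∩ f'.1).card → u e f * u e' f' = 0
  proj : ∀ e x, IsStarProjection (P e x)
  mul_of_mem : ∀ e x f, x ∈ f.1 → P e x * u e f = u e f
  mul_of_notMem : ∀ e x f, x ∉ f.1 → P e x * u e f = 0

theorem exists_pairCoarsening {u : Pair → Pair → (H →L[ℂ] H)} (hu : IsQuantumPermutation u)
    (h0 : ∀ e e' f f' : Pair, (e.1 ∩ e'.1).card ≠ (f.1 ∩ f'.1).card → u e f * u e' f' = 0) :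
    ∃ P, PairCoarsening u P := by
  choose P h1 h2 h3 using fun (e : Pair) (x : ℕ) =>
    exists_coarsening (u e) (hu.isStarProjection e) (hu.row_orthogonal e) {f | x ∈ f.1}
  exact ⟨P, { hu with mul_eq_zero := h0, proj := h1, mul_of_mem := h2, mul_of_notMem := h3 }⟩

namespace PairCoarsening

variable {u : Pair → Pair → (H →L[ℂ] H)} {P : Pair → ℕ → (H →L[ℂ] H)}

theorem of_mem_mul (h : PairCoarsening u P) {e f : Pair} {x : ℕ} (hx : x ∈ f.1) :
    u e f * P e x = u e f := by
  have := congrArg star (h.mul_of_mem e x f hx)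
  rwa [star_mul, (h.proj e x).isSelfAdjoint.star_eq,
    (h.isStarProjection e f).isSelfAdjoint.star_eq] at this

theorem of_notMem_mul (h : PairCoarsening u P) {e f : Pair} {x : ℕ} (hx : x ∉ f.1) :
    u e f * P e x = 0 := by
  have := congrArg star (h.mul_of_notMem e x f hx)
  rwa [star_mul, (h.proj e x).isSelfAdjoint.star_eq,
    (h.isStarProjection e f).isSelfAdjoint.star_eq, star_zero] at this

theorem mul_eq_zero_of_disjoint (h : PairCoarsening u P) {e e' : Pair}
    (he : (e.1 ∩ e'.1).card = 0) (x : ℕ) : P e x * P e' x = 0 := by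
  refine eq_of_row_mul_eq (h.row_sum e) fun f => eq_of_mul_row_eq (h.row_sum e') fun f' => ?_
  rw [mul_zero, zero_mul, ← mul_assoc, mul_assoc]
  by_cases hf : x ∈ f.1
  · by_cases hf' : x ∈ f'.1
    · rw [h.of_mem_mul hf, h.mul_of_mem _ _ _ hf', h.mul_eq_zero]
      rw [he]
      exact (Finset.card_pos.2 ⟨x, Finset.mem_inter.2 ⟨hf, hf'⟩⟩).ne
    · rw [h.mul_of_notMem _ _ _ hf', mul_zero]
  · rw [h.of_notMem_mul hf, zero_mul]

/-- If `e'` goes to `{x, y}`, the image of `e` meets `{x, y}` in exactly one point, so exactly one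
of the two events occurs. -/
theorem add_mul_of_share (h : PairCoarsening u P) {e e' : Pair}
    (he : (e.1 ∩ e'.1).card = 1) {x y : ℕ} (hxy : x ≠ y) :
    (P e x + P e y) * u e' (pair x y) = u e' (pair x y) := by
  refine eq_of_row_mul_eq (h.row_sum e) fun f => ?_
  rw [← mul_assoc, mul_add]
  by_cases hx : x ∈ f.1 <;> by_cases hy : y ∈ f.1
  · have : u e f * u e' (pair x y) = 0 := by
      refine h.mul_eq_zero _ _ _ _ ?_
      rw [he, (Pair.card_inter_eq_two_iff _ _).2 (pair_eq_of_mem hxy hx hy)]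
      decide
    rw [h.of_mem_mul hx, h.of_mem_mul hy, add_mul, this, add_zero]
  · rw [h.of_mem_mul hx, h.of_notMem_mul hy, add_zero]
  · rw [h.of_notMem_mul hx, h.of_mem_mul hy, zero_add]
  · have : u e f * u e' (pair x y) = 0 := by
      refine h.mul_eq_zero _ _ _ _ ?_
      rw [he]
      intro h1
      obtain ⟨z, hz⟩ := Finset.card_pos.1 (h1 ▸ Nat.one_pos)
      rw [Finset.mem_inter, mem_pair hxy] at hz
      rcases hz with ⟨hz, rfl | rfl⟩ <;> contradiction
    rw [h.of_notMem_mul hx, h.of_notMem_mul hy, add_zero, zero_mul, this]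

theorem mul_eq (h : PairCoarsening u P) (e : Pair) {x y : ℕ} (hxy : x ≠ y) :
    P e x * P e y = u e (pair x y) := by
  refine eq_of_mul_row_eq (h.row_sum e) fun f => ?_
  have h0 : f ≠ pair x y → u e (pair x y) * u e f = 0 := fun hf =>
    h.row_orthogonal _ _ _ hf.symm
  rw [mul_assoc]
  by_cases hy : y ∈ f.1
  · rw [h.mul_of_mem _ _ _ hy]
    by_cases hx : x ∈ f.1
    · rw [h.mul_of_mem _ _ _ hx, ← pair_eq_of_mem hxy hx hy,
        (h.isStarProjection e f).isIdempotentElem.eq]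
    · rw [h.mul_of_notMem _ _ _ hx, h0]
      rintro rfl
      exact hx ((mem_pair hxy).2 (Or.inl rfl))
  · rw [h.mul_of_notMem _ _ _ hy, mul_zero, h0]
    rintro rfl
    exact hy ((mem_pair hxy).2 (Or.inr rfl))

theorem isStarProjection_add (h : PairCoarsening u P) {e e' : Pair}
    (he : (e.1 ∩ e'.1).card = 0) (x : ℕ) : IsStarProjection (P e x + P e' x) :=
  (h.proj e x).add (h.proj e' x) (h.mul_eq_zero_of_disjoint he x)

/-- On the range of `u g {x,y}` the projections `P e x + P e' x` and `P e y + P e' y` add up to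
twice the identity, so each fixes that range. -/
theorem add_mul_eq (h : PairCoarsening u P) {e e' g : Pair} (he : (e.1 ∩ e'.1).card = 0)
    (h1 : (e.1 ∩ g.1).card = 1) (h2 : (e'.1 ∩ g.1).card = 1) (x : ℕ) :
    (P e x + P e' x) * P g x = P g x := by
  refine eq_of_mul_row_eq (h.row_sum g) fun f => ?_
  rw [mul_assoc]
  by_cases hx : x ∈ f.1
  · rw [h.mul_of_mem _ _ _ hx]
    obtain ⟨y, hxy, rfl⟩ := Pair.exists_eq_pair_of_mem hx
    refine starProjection_mul_eq_of_add_mul (h.isStarProjection_add he x)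
      (h.isStarProjection_add he y) ?_
    rw [add_add_add_comm, add_mul, h.add_mul_of_share h1 hxy, h.add_mul_of_share h2 hxy]
  · rw [h.mul_of_notMem _ _ _ hx, mul_zero]

/-- The sum of the coarsenings over the two halves of a partition of a four-element set into pairs
does not depend on the partition. -/
theorem add_eq_add (h : PairCoarsening u P) {a b c d : ℕ} (hab : a ≠ b) (hac : a ≠ c)
    (had : a ≠ d) (hbc : b ≠ c) (hbd : b ≠ d) (hcd : c ≠ d) (x : ℕ) :
    P (pair a b) x + P (pair c d) x = P (pair a c) x + P (pair b d) x := by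
  have d1 := card_inter_pair_disjoint hab hcd hac had hbc hbd
  have d2 := card_inter_pair_disjoint hac hbd hab had hbc.symm hcd
  have s1 := card_inter_pair_share hab hac hbc
  have s2 : ((pair a b).1 ∩ (pair b d).1).card = 1 := by
    rw [pair_comm a b]; exact card_inter_pair_share hab.symm hbd had
  have s3 : ((pair c d).1 ∩ (pair a c).1).card = 1 := by
    rw [pair_comm a c]; exact card_inter_pair_share hcd hac.symm had.symm
  have s4 : ((pair c d).1 ∩ (pair b d).1).card = 1 := by
    rw [pair_comm b d, pair_comm c d]; exact card_inter_pair_share hcd.symm hbd.symm hbc.symm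
  have e1 := h.add_mul_eq d1 s1 s3 x
  have e2 := h.add_mul_eq d1 s2 s4 x
  have e3 := h.add_mul_eq d2 (by rwa [Finset.inter_comm]) (by rwa [Finset.inter_comm]) (x := x)
    (g := pair a b)
  have e4 := h.add_mul_eq d2 (by rwa [Finset.inter_comm]) (by rwa [Finset.inter_comm]) (x := x)
    (g := pair c d)
  have e5 : (P (pair a b) x + P (pair c d) x) * (P (pair a c) x + P (pair b d) x)
      = P (pair a c) x + P (pair b d) x := by rw [mul_add, e1, e2]
  have e6 : (P (pair a c) x + P (pair b d) x) * (P (pair a b) x + P (pair c d) x)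
      = P (pair a b) x + P (pair c d) x := by rw [mul_add, e3, e4]
  -- Each of the two projections absorbs the other, and taking adjoints shows that they are equal.
  rw [← e6]
  have := congrArg star e5
  rwa [star_mul, (h.isStarProjection_add d1 x).isSelfAdjoint.star_eq,
    (h.isStarProjection_add d2 x).isSelfAdjoint.star_eq] at this

/-- The coarsenings come from a family of projections indexed by the points. -/
theorem exists_pointwise (h : PairCoarsening u P) : ∃ v : ℕ → ℕ → (H →L[ℂ] H),
    (∀ a b x, a ≠ b → P (pair a b) x = v a x + v b x) ∧ (∀ a x, IsIdempotentElem (v a x)) ∧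
      (∀ a b x, a ≠ b → v a x * v b x = 0) ∧ ∀ a x, IsSelfAdjoint (v a x) := by
  choose v hv using fun x : ℕ => exists_add_of_exchange (fun a b => P (pair a b) x)
    (fun a b => by rw [pair_comm]) (fun a b c d hab hac had hbc hbd hcd =>
      h.add_eq_add hab hac had hbc hbd hcd x)
  have key := fun x => orthogonal_idempotents_of_add (v x)
    (fun a b hab => by
      rw [← hv x a b hab]
      exact (h.proj _ x).isIdempotentElem)
    (fun a b c d hab hac had hbc hbd hcd => by
      rw [← hv x a b hab, ← hv x c d hcd]
      exact h.mul_eq_zero_of_disjoint (card_inter_pair_disjoint hab hcd hac had hbc hbd) x)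
  refine ⟨fun a x => v x a, fun a b x => hv x a b, fun a x => (key x).1 a,
    fun a b x => (key x).2 a b, fun a x => ?_⟩
  -- The product of two projections equals `v x a` in either order, so `v x a` is self-adjoint.
  have e1 : v x a = P (pair a (a + 1)) x * P (pair a (a + 2)) x := by
    rw [hv x a (a + 1) (by omega), hv x a (a + 2) (by omega), add_mul, mul_add, mul_add,
      (key x).2 a (a + 2) (by omega), (key x).2 (a + 1) a (by omega),
      (key x).2 (a + 1) (a + 2) (by omega), ((key x).1 a).eq]
    simp
  have e2 : v x a = P (pair a (a + 2)) x * P (pair a (a + 1)) x := by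
    rw [hv x a (a + 1) (by omega), hv x a (a + 2) (by omega), add_mul, mul_add, mul_add,
      (key x).2 a (a + 1) (by omega), (key x).2 (a + 2) a (by omega),
      (key x).2 (a + 2) (a + 1) (by omega), ((key x).1 a).eq]
    simp
  change star (v x a) = v x a
  conv_lhs => rw [e1]
  rw [star_mul, (h.proj _ x).isSelfAdjoint.star_eq, (h.proj _ x).isSelfAdjoint.star_eq, ← e2]

/-- An operator which factors in the same way through infinitely many entries of a column of a
quantum permutation vanishes. -/
theorem _root_.QuantumSymmetry.IsQuantumPermutation.eq_zero_of_forall_mul {V : Type v}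
    {u : V → V → (H →L[ℂ] H)} (hu : IsQuantumPermutation u) (y : V) (z : ℕ → V)
    (hz : Function.Injective z) {S T W : H →L[ℂ] H} (hW : ∀ n, W = S * u (z n) y * T) :
    W = 0 := by
  ext ξ
  have h1 : Summable fun n => S (u (z n) y (T ξ)) :=
    ((hu.col_sum y (T ξ)).mapL S).summable.comp_injective hz
  have h2 : (fun n => S (u (z n) y (T ξ))) = fun _ : ℕ => W ξ := by
    funext n
    rw [hW n]
    rfl
  rw [h2, summable_const_iff] at h1
  simpa using h1

theorem entries_commute (h : PairCoarsening u P) (e f e' f' : Pair) :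
    u e f * u e' f' = u e' f' * u e f := by
  obtain ⟨v, hv, idem, col, sa⟩ := h.exists_pointwise
  have row : ∀ a x y, x ≠ y → v a x * v a y = 0 := by
    intro a x y hxy
    refine h.toIsQuantumPermutation.eq_zero_of_forall_mul (pair x y)
      (fun n => pair a (a + 1 + n)) ?_ (S := v a x) (T := v a y) fun n => ?_
    · intro m n hmn
      dsimp only at hmn
      have hm : a + 1 + m ∈ (pair a (a + 1 + n)).1 := by
        rw [← hmn]
        exact (mem_pair (by omega)).2 (Or.inr rfl)
      rw [mem_pair (by omega)] at hm
      omega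
    · have han : a ≠ a + 1 + n := by omega
      have e1 : v a x * P (pair a (a + 1 + n)) x = v a x := by
        rw [hv _ _ _ han, mul_add, (idem a x).eq, col _ _ _ han, add_zero]
      have e2 : P (pair a (a + 1 + n)) y * v a y = v a y := by
        rw [hv _ _ _ han, add_mul, (idem a y).eq, col _ _ _ han.symm, add_zero]
      rw [← h.mul_eq _ hxy, ← mul_assoc, e1, mul_assoc, e2]
  have comm : ∀ a b x y, Commute (v a x) (v b y) := by
    intro a b x y
    rcases eq_or_ne a b with rfl | hab
    · rcases eq_or_ne x y with rfl | hxy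
      · exact Commute.refl _
      · rw [Commute, SemiconjBy, row _ _ _ hxy, row _ _ _ hxy.symm]
    · rcases eq_or_ne x y with rfl | hxy
      · rw [Commute, SemiconjBy, col _ _ _ hab, col _ _ _ hab.symm]
      · have e1 : P (pair a b) x * P (pair a b) y = P (pair a b) y * P (pair a b) x := by
          rw [h.mul_eq _ hxy, h.mul_eq _ hxy.symm, pair_comm x y]
        rw [hv _ _ _ hab, hv _ _ _ hab, add_mul, mul_add, mul_add, add_mul, mul_add, mul_add,
          row _ _ _ hxy, row _ _ _ hxy, row _ _ _ hxy.symm, row _ _ _ hxy.symm, zero_add,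
          add_zero, zero_add, add_zero] at e1
        -- Left multiplication of `e1` by `v a x` kills both mixed terms. The right side obtained is
        -- self-adjoint once `e2` is substituted, which gives commutation.
        have e2 : v a x * v b y = v a x * v b y * v a x := by
          have := congrArg (fun t => v a x * t) e1
          simpa only [mul_add, ← mul_assoc, (idem a x).eq, col _ _ _ hab, row _ _ _ hxy, zero_mul,
            add_zero, zero_add] using this
        have e3 := congrArg star e2
        rw [star_mul, star_mul, star_mul, (sa a x).star_eq, (sa b y).star_eq, ← mul_assoc,
          ← e2] at e3
        exact e3.symm
  have commP : ∀ e e' x y, Commute (P e x) (P e' y) := by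
    intro e e' x y
    obtain ⟨a, b, hab, rfl⟩ := e.exists_eq_pair
    obtain ⟨c, d, hcd, rfl⟩ := e'.exists_eq_pair
    rw [hv _ _ _ hab, hv _ _ _ hcd]
    exact ((comm a c x y).add_right (comm a d x y)).add_left
      ((comm b c x y).add_right (comm b d x y))
  obtain ⟨x, y, hxy, rfl⟩ := f.exists_eq_pair
  obtain ⟨x', y', hxy', rfl⟩ := f'.exists_eq_pair
  rw [← h.mul_eq _ hxy, ← h.mul_eq _ hxy']
  exact ((commP _ _ _ _).mul_right (commP _ _ _ _)).mul_left
    ((commP _ _ _ _).mul_right (commP _ _ _ _))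

end PairCoarsening

theorem entriesCommute_of_adj_iff {G : SimpleGraph Pair} {k : ℕ} (hk : k < 2)
    (hG : ∀ f g, G.Adj f g ↔ (f.1 ∩ g.1).card = k) :
    QuantumAutomorphismEntriesCommute.{0, w} G := by
  intro H _ _ _ u hu
  obtain ⟨P, hP⟩ := exists_pairCoarsening hu.toIsQuantumPermutation fun e e' f f' hne =>
    hu.mul_eq_zero_of_rel_ne _ _ _ _ fun hr => hne (card_inter_eq_of_rel_eq hk hG hr)
  exact hP.entries_commute

theorem QuantumAutomorphismEntriesCommute.hasNoQuantumSymmetry {V : Type v} {G : SimpleGraph V}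
    (h : QuantumAutomorphismEntriesCommute.{v, w} G) : HasNoQuantumSymmetry.{v, w} G := by
  intro H _ _ _ u hu hirr
  exact hirr.finrank_eq_one (h H u hu)

end Commute

end QuantumSymmetry

theorem mainTheorem4 :
    (QuantumSymmetry.HasNoQuantumSymmetry.{0, w} (QuantumSymmetry.johnsonGraph 2) ∧
      QuantumSymmetry.QuantumAutomorphismEntriesCommute.{0, w} (QuantumSymmetry.johnsonGraph 2)) ∧
    (QuantumSymmetry.HasNoQuantumSymmetry.{0, w} QuantumSymmetry.kneserGraphTwo ∧
      QuantumSymmetry.QuantumAutomorphismEntriesCommute.{0, w} QuantumSymmetry.kneserGraphTwo) := by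
  have hJ : QuantumSymmetry.QuantumAutomorphismEntriesCommute.{0, w}
      (QuantumSymmetry.johnsonGraph 2) :=
    QuantumSymmetry.entriesCommute_of_adj_iff (k := 1) (by decide) fun f g => by
      change (f.1 ∩ g.1).card + 1 = 2 ↔ _
      omega
  have hK : QuantumSymmetry.QuantumAutomorphismEntriesCommute.{0, w}
      QuantumSymmetry.kneserGraphTwo :=
    QuantumSymmetry.entriesCommute_of_adj_iff (k := 0) (by decide) fun f g =>
      Finset.card_eq_zero.symm
  exact ⟨⟨hJ.hasNoQuantumSymmetry, hJ⟩, hK.hasNoQuantumSymmetry, hK⟩
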